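/- Let $k,m,n\ge 1$ be integers, let $M_k$ denote the complex $k\times k$ matrices, and identify $M_k\otimes M_m$ with $M_{km}$ via the Kronecker product. Let $A=\sum_{i=1}^n A_i\otimes B_i\in M_k\otimes M_m$ be a positive semidefinite Hermitian matrix, and define $G_A:M_k\to M_m$ and $F_A:M_m\to M_k$ by $G_A(X)=\sum_{i=1}^n B_i\,\mathrm{tr}(A_iX)$ and $F_A(X)=\sum_{i=1}^n A_i\,\mathrm{tr}(B_iX)$. Suppose that $G_A(\mathrm{Id})$ and $F_A(\mathrm{Id})$ are positive definite Hermitian matrices and that $$\dim(\ker A)<\frac{\max\{k,m\}}{\min\{k,m\}}.$$ Then $A$ can be put in the filter normal form, that is, there are invertible matrices $X'\in M_k$, $Y'\in M_m$ and matrices $C_1,\dots,C_n\in M_k$, $D_1,\dots,D_n\in M_m$ such that $$(X'\otimes Y')A(X'\otimes Y')^*=\sum_{i=1}^n C_i\otimes D_i,\qquad C_1=\frac{\mathrm{Id}}{\sqrt k},\quad D_1=\frac{\mathrm{Id}}{\sqrt m},$$ and $\mathrm{tr}(C_iC_j)=\mathrm{tr}(D_iD_j)=0$ for all $i\ne j$.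 -/

import Mathlib

open scoped Kronecker ComplexOrder

/-- For `A = ∑ i, P i ⊗ Q i` this is the map `G_A : M_k → M_m`, `G_A(X) = ∑ i, tr(P i * X) Q i`
(it depends only on the sum, see `mapG_apply_eq`). -/
def mapG {k m n : ℕ} (P : Fin n → Matrix (Fin k) (Fin k) ℂ)
    (Q : Fin n → Matrix (Fin m) (Fin m) ℂ) (X : Matrix (Fin k) (Fin k) ℂ) :
    Matrix (Fin m) (Fin m) ℂ :=
  ∑ i, (P i * X).trace • Q i

/-- For `A = ∑ i, P i ⊗ Q i` this is the map `F_A : M_m → M_k`, `F_A(X) = ∑ i, tr(Q i * X) P i`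
(it depends only on the sum, see `mapF_apply_eq`). -/
def mapF {k m n : ℕ} (P : Fin n → Matrix (Fin k) (Fin k) ℂ)
    (Q : Fin n → Matrix (Fin m) (Fin m) ℂ) (X : Matrix (Fin m) (Fin m) ℂ) :
    Matrix (Fin k) (Fin k) ℂ :=
  ∑ i, (Q i * X).trace • P i

/-- `G_A` depends only on `A`: an expression through the entries of `A`. -/
theorem mapG_apply_eq {k m n : ℕ} (P : Fin n → Matrix (Fin k) (Fin k) ℂ)
    (Q : Fin n → Matrix (Fin m) (Fin m) ℂ) (X : Matrix (Fin k) (Fin k) ℂ) (b b' : Fin m) :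
    mapG P Q X b b' = ∑ a, ∑ a', (∑ i, P i ⊗ₖ Q i) (a, b) (a', b') * X a' a := by
  simp only [mapG, Matrix.sum_apply, Matrix.smul_apply, Matrix.trace, Matrix.diag,
    Matrix.mul_apply, Matrix.kroneckerMap_apply, smul_eq_mul, Finset.sum_mul]
  rw [Finset.sum_comm]
  refine Finset.sum_congr rfl fun a _ => ?_
  rw [Finset.sum_comm]
  exact Finset.sum_congr rfl fun a' _ => Finset.sum_congr rfl fun i _ => by ring

/-- `F_A` depends only on `A`: an expression through the entries of `A`. -/
theorem mapF_apply_eq {k m n : ℕ} (P : Fin n → Matrix (Fin k) (Fin k) ℂ)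
    (Q : Fin n → Matrix (Fin m) (Fin m) ℂ) (X : Matrix (Fin m) (Fin m) ℂ) (a a' : Fin k) :
    mapF P Q X a a' = ∑ b, ∑ b', (∑ i, P i ⊗ₖ Q i) (a, b) (a', b') * X b' b := by
  simp only [mapF, Matrix.sum_apply, Matrix.smul_apply, Matrix.trace, Matrix.diag,
    Matrix.mul_apply, Matrix.kroneckerMap_apply, smul_eq_mul, Finset.sum_mul]
  rw [Finset.sum_comm]
  refine Finset.sum_congr rfl fun b _ => ?_
  rw [Finset.sum_comm]
  exact Finset.sum_congr rfl fun b' _ => Finset.sum_congr rfl fun i _ => by ring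

/-- `A ∈ M_k ⊗ M_m` can be put in the filter normal form with `n` terms: there are invertible
`X`, `Y` with `(X ⊗ Y) A (X ⊗ Y)^* = ∑ i, C i ⊗ D i`, where the first terms are `Id / √k` and
`Id / √m`, and `tr(C i * C j) = tr(D i * D j) = 0` for `i ≠ j`. (The first index is `0 : Fin n`;
in particular there is at least one term.) -/
def HasFilterNormalForm {k m : ℕ} (n : ℕ)
    (A : Matrix (Fin k × Fin m) (Fin k × Fin m) ℂ) : Prop :=
  ∃ (X : Matrix (Fin k) (Fin k) ℂ) (Y : Matrix (Fin m) (Fin m) ℂ)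
    (C : Fin n → Matrix (Fin k) (Fin k) ℂ) (D : Fin n → Matrix (Fin m) (Fin m) ℂ),
    IsUnit X ∧ IsUnit Y ∧
    (X ⊗ₖ Y) * A * (X ⊗ₖ Y).conjTranspose = ∑ i, C i ⊗ₖ D i ∧
    (∃ h : 0 < n,
      C ⟨0, h⟩ = (((Real.sqrt k : ℝ) : ℂ)⁻¹) • (1 : Matrix (Fin k) (Fin k) ℂ) ∧
      D ⟨0, h⟩ = (((Real.sqrt m : ℝ) : ℂ)⁻¹) • (1 : Matrix (Fin m) (Fin m) ℂ)) ∧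
    ∀ i j, i ≠ j → (C i * C j).trace = 0 ∧ (D i * D j).trace = 0

/-! The normal form follows once both partial traces of `A` are made scalar. The map `F_A ∘ G_A` is
then symmetric for `tr(XY)`, preserves Hermitian matrices and has `1` as an eigenvector, so it has a
Hermitian trace-orthonormal eigenbasis `c` containing `1/√k`. The expansion `A = ∑ c ⊗ G_A(c)` has
orthogonal second factors, and at most `n` of them are nonzero because they lie in the span of the
`Q i` (`exists_schmidt`).

Scalar partial traces come from minimising `|det G_A(T^* T)|` over `|det T| = 1`. Take `k ≤ m`, the
other case being symmetric, and put `d = dim ker A`. Let `x_M`, `x_μ` be the extreme eigenvalues of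
`T^* T`. All but at most `d` eigenvalues of `G_A(T^* T)` are at least `l x_M`, where `l` is a
spectral gap of `A` (`card_eigenvalue_lt_le`), and all are at least `c x_μ`. Since `x_μ x_M^(k-1) ≥
1`, the determinant is at least a constant times `x_M^(m - k d)`. The kernel hypothesis says exactly
that this exponent is positive, so a minimiser exists. After normalising `G_A(1) = 1`, stationarity
makes `F_A(1)` scalar (`mapF_one_eq_of_extremal`). -/

open Matrix in
/-- The spectral theorem with the unitary as a plain matrix. -/
theorem Matrix.IsHermitian.exists_unitary_diagonal {ι : Type*} [Fintype ι] [DecidableEq ι]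
    {H : Matrix ι ι ℂ} (hH : H.IsHermitian) :
    ∃ (U : Matrix ι ι ℂ) (e : ι → ℝ), Uᴴ * U = 1 ∧ U * Uᴴ = 1 ∧
      H = U * diagonal (fun i => (e i : ℂ)) * Uᴴ := by
  refine ⟨hH.eigenvectorUnitary, hH.eigenvalues, ?_, ?_, ?_⟩
  · exact Unitary.coe_star_mul_self _
  · exact Unitary.coe_mul_star_self _
  · exact hH.spectral_theorem

/-! ### Positivity, covariance and duality of `G_A` and `F_A` -/

section positiveMaps
open Matrix

variable {k m n : ℕ}

/-- `mapG` as a linear map. -/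
def mapGLin (P : Fin n → Matrix (Fin k) (Fin k) ℂ) (Q : Fin n → Matrix (Fin m) (Fin m) ℂ) :
    Matrix (Fin k) (Fin k) ℂ →ₗ[ℂ] Matrix (Fin m) (Fin m) ℂ where
  toFun := mapG P Q
  map_add' X Y := by
    simp [mapG, Matrix.mul_add, add_smul, Finset.sum_add_distrib]
  map_smul' c X := by
    simp [mapG, Finset.smul_sum, smul_smul]

@[simp]
theorem mapGLin_apply (P : Fin n → Matrix (Fin k) (Fin k) ℂ)
    (Q : Fin n → Matrix (Fin m) (Fin m) ℂ) (X : Matrix (Fin k) (Fin k) ℂ) :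
    mapGLin P Q X = mapG P Q X := rfl

/-- The matrix of `w ↦ v ⊗ w`. -/
def tensorLeft (m : ℕ) (v : Fin k → ℂ) : Matrix (Fin k × Fin m) (Fin m) ℂ :=
  of fun p b => v p.1 * (1 : Matrix (Fin m) (Fin m) ℂ) p.2 b

/-- On a rank one matrix `G_A` is the compression of `A` to `v ⊗ ℂ^m`. This gives positivity of
`G_A` and ties its small eigenvalues to the kernel of `A`. -/
theorem mapG_vecMulVec (P : Fin n → Matrix (Fin k) (Fin k) ℂ)
    (Q : Fin n → Matrix (Fin m) (Fin m) ℂ) (v : Fin k → ℂ) :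
    mapG P Q (vecMulVec v (star v)) =
      (tensorLeft m v)ᴴ * (∑ i, P i ⊗ₖ Q i) * tensorLeft m v := by
  ext b b'
  rw [mapG_apply_eq]
  generalize (∑ i, P i ⊗ₖ Q i) = A
  simp only [mul_apply, conjTranspose_apply, tensorLeft, of_apply, Fintype.sum_prod_type,
    one_apply, vecMulVec_apply, mul_ite, mul_one, mul_zero, Finset.sum_ite_eq',
    Finset.mem_univ, if_true, Finset.sum_mul, apply_ite star, star_zero,
    ite_mul, zero_mul]
  rw [Finset.sum_comm]
  refine Finset.sum_congr rfl fun a _ => Finset.sum_congr rfl fun a' _ => ?_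
  rw [Pi.star_apply]
  ring

theorem tensorLeft_conjTranspose_mul_self (v : Fin k → ℂ) :
    (tensorLeft m v)ᴴ * tensorLeft m v = (star v ⬝ᵥ v) • (1 : Matrix (Fin m) (Fin m) ℂ) := by
  ext b b'
  simp only [mul_apply, conjTranspose_apply, tensorLeft, of_apply, Fintype.sum_prod_type,
    one_apply, mul_ite, mul_one, mul_zero, Finset.sum_ite_eq', Finset.mem_univ, if_true,
    apply_ite star, star_zero, Matrix.smul_apply, smul_eq_mul, dotProduct, Pi.star_apply]
  simp [eq_comm]

theorem mapG_posSemidef {P : Fin n → Matrix (Fin k) (Fin k) ℂ}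
    {Q : Fin n → Matrix (Fin m) (Fin m) ℂ} (hA : (∑ i, P i ⊗ₖ Q i).PosSemidef)
    {X : Matrix (Fin k) (Fin k) ℂ} (hX : X.PosSemidef) : (mapG P Q X).PosSemidef := by
  obtain ⟨r, v, rfl⟩ := posSemidef_iff_eq_sum_vecMulVec.mp hX
  rw [← mapGLin_apply, map_sum]
  refine posSemidef_sum _ fun i _ => ?_
  rw [mapGLin_apply, mapG_vecMulVec]
  exact hA.conjTranspose_mul_mul_same _

theorem mapG_conj (P : Fin n → Matrix (Fin k) (Fin k) ℂ)
    (Q : Fin n → Matrix (Fin m) (Fin m) ℂ) (U : Matrix (Fin k) (Fin k) ℂ)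
    (V : Matrix (Fin m) (Fin m) ℂ) (X : Matrix (Fin k) (Fin k) ℂ) :
    mapG (fun i => U * P i * Uᴴ) (fun i => V * Q i * Vᴴ) X = V * mapG P Q (Uᴴ * X * U) * Vᴴ := by
  simp only [mapG, Matrix.mul_sum, Matrix.sum_mul, Matrix.mul_smul, Matrix.smul_mul]
  refine Finset.sum_congr rfl fun i _ => ?_
  congr 1
  rw [trace_mul_comm, ← trace_mul_comm (Uᴴ * X * U)]
  rw [← Matrix.mul_assoc, trace_mul_comm]
  simp only [Matrix.mul_assoc]

theorem sum_kronecker_conj (P : Fin n → Matrix (Fin k) (Fin k) ℂ)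
    (Q : Fin n → Matrix (Fin m) (Fin m) ℂ) (U : Matrix (Fin k) (Fin k) ℂ)
    (V : Matrix (Fin m) (Fin m) ℂ) :
    (U ⊗ₖ V) * (∑ i, P i ⊗ₖ Q i) * (U ⊗ₖ V)ᴴ = ∑ i, (U * P i * Uᴴ) ⊗ₖ (V * Q i * Vᴴ) := by
  simp only [Matrix.mul_sum, Matrix.sum_mul, conjTranspose_kronecker, mul_kronecker_mul]

/-- `F_A` is by definition `mapG` with the families exchanged, so this is the adjointness of `G_A`
and `F_A` for the trace pairing. -/
theorem trace_mul_mapG (P : Fin n → Matrix (Fin k) (Fin k) ℂ)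
    (Q : Fin n → Matrix (Fin m) (Fin m) ℂ) (X : Matrix (Fin k) (Fin k) ℂ)
    (Y : Matrix (Fin m) (Fin m) ℂ) :
    (Y * mapG P Q X).trace = (X * mapG Q P Y).trace := by
  simp only [mapG, Matrix.mul_sum, Matrix.mul_smul, trace_sum, trace_smul, smul_eq_mul]
  refine Finset.sum_congr rfl fun i _ => ?_
  rw [trace_mul_comm Y, trace_mul_comm X, mul_comm]

end positiveMaps

/-! ### Coercivity of the determinant from the bound on the kernel -/

section coercivity
open Matrix

theorem star_mulVec_dotProduct_mulVec_mulVec {ι κ : Type*} [Fintype ι] [Fintype κ]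
    (B : Matrix ι κ ℂ) (M : Matrix ι ι ℂ) (c : κ → ℂ) :
    star (B *ᵥ c) ⬝ᵥ M *ᵥ (B *ᵥ c) = star c ⬝ᵥ (Bᴴ * M * B) *ᵥ c := by
  rw [star_mulVec, ← dotProduct_mulVec, mulVec_mulVec, mulVec_mulVec, Matrix.mul_assoc]

theorem posSemidef_conj_diagonal_iff {ι : Type*} [Fintype ι] [DecidableEq ι] {U : Matrix ι ι ℂ}
    (hU : Uᴴ * U = 1) (e : ι → ℝ) :
    (U * diagonal (fun i => (e i : ℂ)) * Uᴴ).PosSemidef ↔ ∀ i, 0 ≤ e i := by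
  refine ⟨fun h i => ?_, fun h => PosSemidef.mul_mul_conjTranspose_same
    (posSemidef_diagonal_iff.mpr fun i => by exact_mod_cast h i) U⟩
  have h := h.conjTranspose_mul_mul_same U
  rw [show Uᴴ * (U * diagonal (fun i => (e i : ℂ)) * Uᴴ) * U =
    (Uᴴ * U) * diagonal (fun i => (e i : ℂ)) * (Uᴴ * U) by simp only [Matrix.mul_assoc], hU,
    Matrix.one_mul, Matrix.mul_one, posSemidef_diagonal_iff] at h
  exact_mod_cast h i

theorem conj_diagonal_sub_smul {ι : Type*} [Fintype ι] [DecidableEq ι] (U : Matrix ι ι ℂ)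
    (e f : ι → ℝ) (b : ℝ) :
    U * diagonal (fun i => (e i : ℂ)) * Uᴴ - (b : ℂ) • (U * diagonal (fun i => (f i : ℂ)) * Uᴴ) =
      U * diagonal (fun i => ((e i - b * f i : ℝ) : ℂ)) * Uᴴ := by
  rw [← Matrix.smul_mul, ← Matrix.mul_smul, ← Matrix.sub_mul, ← Matrix.mul_sub]
  congr 2
  ext i j
  by_cases hij : i = j
  · subst hij
    simp
  · simp [hij]

theorem det_conj_diagonal {ι : Type*} [Fintype ι] [DecidableEq ι] {U : Matrix ι ι ℂ}
    (hU : Uᴴ * U = 1) (e : ι → ℝ) :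
    (U * diagonal (fun i => (e i : ℂ)) * Uᴴ).det = ((∏ i, e i : ℝ) : ℂ) := by
  rw [det_mul_comm, ← Matrix.mul_assoc, hU, Matrix.one_mul, det_diagonal, Complex.ofReal_prod]

theorem trace_conj_diagonal {ι : Type*} [Fintype ι] [DecidableEq ι] {U : Matrix ι ι ℂ}
    (hU : Uᴴ * U = 1) (e : ι → ℝ) :
    (U * diagonal (fun i => (e i : ℂ)) * Uᴴ).trace = ((∑ i, e i : ℝ) : ℂ) := by
  rw [trace_mul_comm, ← Matrix.mul_assoc, hU, Matrix.one_mul, trace_diagonal, Complex.ofReal_sum]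

/-- The nonzero eigenvalues of a positive semidefinite matrix are bounded below. -/
theorem Matrix.PosSemidef.exists_spectral_gap {ι : Type*} [Fintype ι] [DecidableEq ι]
    {A : Matrix ι ι ℂ} (hA : A.PosSemidef) :
    ∃ l : ℝ, 0 < l ∧ (A * A * A - (l : ℂ) • (A * A)).PosSemidef := by
  obtain ⟨U, e, h1, h2, h3⟩ := hA.isHermitian.exists_unitary_diagonal
  have he : ∀ i, 0 ≤ e i := by
    rwa [h3, posSemidef_conj_diagonal_iff h1] at hA
  -- `l` is the least positive eigenvalue; if there is none, any positive value such as `1` works.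
  obtain ⟨l, hl, hle⟩ : ∃ l : ℝ, 0 < l ∧ ∀ i, 0 < e i → l ≤ e i := by
    rcases (Finset.univ.filter fun i => 0 < e i).eq_empty_or_nonempty with h | h
    · refine ⟨1, one_pos, fun i hi => ?_⟩
      have : i ∈ (Finset.univ.filter fun i => 0 < e i) := by simp [hi]
      simp [h] at this
    · obtain ⟨j, hj, hmin⟩ := Finset.exists_min_image _ e h
      exact ⟨e j, by simpa using hj, fun i hi => hmin i (by simp [hi])⟩
  refine ⟨l, hl, ?_⟩
  have hAA : A * A = U * (diagonal (fun i => (e i : ℂ)) * diagonal (fun i => (e i : ℂ))) * Uᴴ := by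
    rw [h3, show U * diagonal (fun i => (e i : ℂ)) * Uᴴ * (U * diagonal (fun i => (e i : ℂ)) * Uᴴ)
      = U * diagonal (fun i => (e i : ℂ)) * (Uᴴ * U) * diagonal (fun i => (e i : ℂ)) * Uᴴ by
        simp only [Matrix.mul_assoc], h1]
    simp only [Matrix.mul_assoc, Matrix.one_mul]
  have hAAA : A * A * A - (l : ℂ) • (A * A) =
      U * diagonal (fun i => ((e i * e i * (e i - l) : ℝ) : ℂ)) * Uᴴ := by
    have hd : diagonal (fun i => ((e i * e i * (e i - l) : ℝ) : ℂ)) =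
        diagonal (fun i => (e i : ℂ)) * diagonal (fun i => (e i : ℂ)) *
          diagonal (fun i => (e i : ℂ)) -
        (l : ℂ) • (diagonal (fun i => (e i : ℂ)) * diagonal (fun i => (e i : ℂ))) := by
      ext i j
      by_cases hij : i = j
      · subst hij
        simp
        ring
      · simp [hij]
    rw [hAA, hd]
    nth_rewrite 1 [h3]
    rw [Matrix.mul_sub, Matrix.sub_mul, Matrix.mul_smul, Matrix.smul_mul]
    congr 1
    calc _ = U * (diagonal (fun i => (e i : ℂ)) * diagonal (fun i => (e i : ℂ))) * (Uᴴ * U) *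
          diagonal (fun i => (e i : ℂ)) * Uᴴ := by simp only [Matrix.mul_assoc]
      _ = _ := by rw [h1]; simp only [Matrix.mul_assoc, Matrix.one_mul]
  rw [hAAA]
  refine (posSemidef_conj_diagonal_iff h1 _).mpr fun i => ?_
  rcases (he i).eq_or_lt with h | h
  · simp [← h]
  · exact mul_nonneg (by positivity) (sub_nonneg.mpr (hle i h))

variable {k m n : ℕ} {P : Fin n → Matrix (Fin k) (Fin k) ℂ} {Q : Fin n → Matrix (Fin m) (Fin m) ℂ}

/-- If `X` dominates `s` times a rank one projection then `G_A(X)` has few small eigenvalues. -/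
theorem card_eigenvalue_lt_le {A : Matrix (Fin k × Fin m) (Fin k × Fin m) ℂ}
    (hA : A = ∑ i, P i ⊗ₖ Q i) (hpsd : A.PosSemidef) {l : ℝ}
    (hl : (A * A * A - (l : ℂ) • (A * A)).PosSemidef)
    {X : Matrix (Fin k) (Fin k) ℂ} {v : Fin k → ℂ} (hv : star v ⬝ᵥ v = 1) {s : ℝ} (hs : 0 < s)
    (hX : (X - (s : ℂ) • vecMulVec v (star v)).PosSemidef)
    {U : Matrix (Fin m) (Fin m) ℂ} {e : Fin m → ℝ} (hU : Uᴴ * U = 1)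
    (hG : mapG P Q X = U * diagonal (fun i => (e i : ℂ)) * Uᴴ) :
    (Finset.univ.filter fun j => e j < s * l).card ≤ Module.finrank ℂ (LinearMap.ker A.mulVecLin) := by
  classical
  by_contra hcon
  push Not at hcon
  rw [← Fintype.card_subtype] at hcon
  set J := {j // e j < s * l}
  change _ < Fintype.card J at hcon
  -- The columns of `W` are the eigenvectors with small eigenvalue; `K` embeds their span
  -- isometrically as `v ⊗ w`.
  set W : Matrix (Fin m) J ℂ := U.submatrix id Subtype.val with hW
  have hWD (D : Matrix (Fin m) (Fin m) ℂ) : Wᴴ * (U * D * Uᴴ) * W =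
      D.submatrix Subtype.val Subtype.val := by
    have : Wᴴ * (U * D * Uᴴ) * W =
        (Uᴴ * (U * D * Uᴴ) * U).submatrix Subtype.val Subtype.val := by
      rw [submatrix_mul _ _ _ id _ Function.bijective_id,
        submatrix_mul _ _ _ id _ Function.bijective_id]
      rfl
    rw [this, show Uᴴ * (U * D * Uᴴ) * U = (Uᴴ * U) * D * (Uᴴ * U) by
      simp only [Matrix.mul_assoc], hU, Matrix.one_mul, Matrix.mul_one]
  have hWW : Wᴴ * W = 1 := by
    have : Wᴴ * W = (Uᴴ * U).submatrix Subtype.val Subtype.val := by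
      rw [submatrix_mul _ _ _ id _ Function.bijective_id]
      rfl
    rw [this, hU, submatrix_one _ Subtype.val_injective]
  set K := tensorLeft m v * W with hK
  have hKK : Kᴴ * K = 1 := by
    rw [hK, conjTranspose_mul, Matrix.mul_assoc, ← Matrix.mul_assoc _ _ W,
      tensorLeft_conjTranspose_mul_self, hv, one_smul, Matrix.one_mul, hWW]
  have hKAK : Kᴴ * A * K = Wᴴ * mapG P Q (vecMulVec v (star v)) * W := by
    rw [mapG_vecMulVec, ← hA, hK, conjTranspose_mul]
    simp only [Matrix.mul_assoc]
  have hKinj : Function.Injective K.mulVecLin := by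
    intro x y hxy
    have := congrArg (fun z => Kᴴ *ᵥ z) hxy
    simpa [mulVec_mulVec, hKK] using this
  -- The range of `A` has codimension `dim ker A`, smaller than the dimension of the range of `K`,
  -- so the two ranges meet nontrivially.
  obtain ⟨c, hc, y, hy⟩ : ∃ c : J → ℂ, c ≠ 0 ∧ ∃ y, A *ᵥ y = K *ᵥ c := by
    by_contra hno
    push Not at hno
    have hdisj : Disjoint (LinearMap.range A.mulVecLin) (LinearMap.range K.mulVecLin) := by
      rw [Submodule.disjoint_def]
      rintro x ⟨y, hy⟩ ⟨c, hc⟩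
      by_cases h0 : c = 0
      · rw [← hc, h0, map_zero]
      · exact absurd (hy.trans hc.symm) (hno c h0 y)
    have h1 := Submodule.finrank_add_finrank_le_of_disjoint hdisj
    rw [LinearMap.finrank_range_of_inj hKinj] at h1
    have h2 := LinearMap.finrank_range_add_finrank_ker A.mulVecLin
    rw [Module.finrank_fintype_fun_eq_card] at h1
    omega
  set q := star c ⬝ᵥ (Kᴴ * A * K) *ᵥ c with hq
  -- With `A y = K c`, the gap inequality `A³ ≥ l A²` evaluated at `y` says that `A ≥ l` at the
  -- vector `K c`.
  have hq1 : 0 ≤ q - l * (star c ⬝ᵥ c) := by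
    have h := hl.dotProduct_mulVec_nonneg y
    rw [sub_mulVec, smul_mulVec, dotProduct_sub, dotProduct_smul, smul_eq_mul] at h
    have e1 : star y ⬝ᵥ (A * A * A) *ᵥ y = q := by
      rw [hq, ← star_mulVec_dotProduct_mulVec_mulVec, ← hy, star_mulVec_dotProduct_mulVec_mulVec,
        hpsd.isHermitian.eq]
    have e2 : star y ⬝ᵥ (A * A) *ᵥ y = star c ⬝ᵥ c := by
      have := star_mulVec_dotProduct_mulVec_mulVec A 1 y
      rw [hpsd.isHermitian.eq, Matrix.mul_one, hy, star_mulVec_dotProduct_mulVec_mulVec,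
        Matrix.mul_one, hKK, one_mulVec] at this
      exact this.symm
    rwa [e1, e2] at h
  -- Positivity of `G_A` applied to `X - s v v^*` and tested at `W c`. With `hq1` this contradicts
  -- all `e j` on `J` being below `s l`.
  have hq2 : 0 ≤ star c ⬝ᵥ (diagonal fun j : J => (e j : ℂ)) *ᵥ c - s * q := by
    have h := (mapG_posSemidef (hA ▸ hpsd) hX).dotProduct_mulVec_nonneg (W *ᵥ c)
    rw [← mapGLin_apply, map_sub, map_smul, mapGLin_apply, mapGLin_apply, hG,
      star_mulVec_dotProduct_mulVec_mulVec, Matrix.mul_sub, Matrix.sub_mul, Matrix.mul_smul,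
      Matrix.smul_mul, ← hKAK, hWD, sub_mulVec, smul_mulVec, dotProduct_sub, dotProduct_smul,
      smul_eq_mul, submatrix_diagonal _ _ Subtype.val_injective] at h
    exact h
  have hN : star c ⬝ᵥ c = ((∑ j, ‖c j‖ ^ 2 : ℝ) : ℂ) := by
    simp [dotProduct, Complex.conj_mul']
  have hE : star c ⬝ᵥ (diagonal fun j : J => (e j : ℂ)) *ᵥ c =
      ((∑ j : J, e j * ‖c j‖ ^ 2 : ℝ) : ℂ) := by
    simp only [dotProduct, mulVec_diagonal, Pi.star_apply, Complex.ofReal_sum]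
    refine Finset.sum_congr rfl fun j _ => ?_
    push_cast
    rw [← Complex.conj_mul', Complex.star_def]
    ring
  have hr1 := (Complex.le_def.mp hq1).1
  have hr2 := (Complex.le_def.mp hq2).1
  rw [hN, ← Complex.ofReal_mul] at hr1
  rw [hE] at hr2
  simp only [Complex.zero_re, Complex.sub_re, Complex.ofReal_re, Complex.re_ofReal_mul] at hr1 hr2
  obtain ⟨j0, hj0⟩ := Function.ne_iff.mp hc
  have hlt : ∑ j : J, e j * ‖c j‖ ^ 2 < ∑ j : J, s * l * ‖c j‖ ^ 2 := by
    refine Finset.sum_lt_sum (fun j _ => mul_le_mul_of_nonneg_right j.2.le (by positivity))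
      ⟨j0, Finset.mem_univ _, mul_lt_mul_of_pos_right j0.2 ?_⟩
    have := norm_pos_iff.mpr hj0
    positivity
  rw [← Finset.mul_sum] at hlt
  nlinarith [mul_nonneg hs.le hr1]

theorem Matrix.PosDef.exists_sub_smul_one_posSemidef {ι : Type*} [Fintype ι] [DecidableEq ι]
    {H : Matrix ι ι ℂ} (hH : H.PosDef) (b : ℝ) (hb : 0 < b) :
    ∃ c : ℝ, 0 < c ∧ c ≤ b ∧ (H - (c : ℂ) • 1).PosSemidef := by
  obtain ⟨U, e, h1, h2, h3⟩ := hH.isHermitian.exists_unitary_diagonal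
  have he0 : ∀ i, 0 ≤ e i := by
    have := hH.posSemidef
    rwa [h3, posSemidef_conj_diagonal_iff h1] at this
  have he : ∀ i, 0 < e i := by
    have hdet := hH.det_pos.ne'
    rw [h3, det_conj_diagonal h1, Complex.ofReal_ne_zero, Finset.prod_ne_zero_iff] at hdet
    exact fun i => (he0 i).lt_of_ne (hdet i (Finset.mem_univ _)).symm
  obtain ⟨l, hl, hle⟩ : ∃ l : ℝ, 0 < l ∧ ∀ i, l ≤ e i := by
    cases isEmpty_or_nonempty ι
    · exact ⟨1, one_pos, fun i => isEmptyElim i⟩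
    · obtain ⟨j, hj⟩ := Finite.exists_min e
      exact ⟨e j, he j, hj⟩
  refine ⟨min l b, lt_min hl hb, min_le_right _ _, ?_⟩
  have h := conj_diagonal_sub_smul U e 1 (min l b)
  simp only [Pi.one_apply, Complex.ofReal_one, diagonal_one, h2, ← h3, mul_one] at h
  rw [h, posSemidef_conj_diagonal_iff h1]
  exact fun i => sub_nonneg.mpr ((min_le_left _ _).trans (hle i))

/-- A product with at most `d` factors below `a`, all of them at least `b`. -/
theorem pow_mul_pow_le_prod {ι : Type*} [Fintype ι] {e : ι → ℝ} {a b : ℝ} {d : ℕ} (hb : 0 < b)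
    (hab : b ≤ a) (hbe : ∀ i, b ≤ e i) (hd : (Finset.univ.filter fun i => e i < a).card ≤ d)
    (hdm : d ≤ Fintype.card ι) : a ^ (Fintype.card ι - d) * b ^ d ≤ ∏ i, e i := by
  have ha : 0 < a := hb.trans_le hab
  set r := (Finset.univ.filter fun i => e i < a).card with hr
  have hcard : (Finset.univ.filter fun i => ¬ e i < a).card = Fintype.card ι - r := by
    have := Finset.card_filter_add_card_filter_not (s := (Finset.univ : Finset ι))
      (fun i => e i < a)
    rw [Finset.card_univ] at this
    omega
  rw [← Finset.prod_filter_mul_prod_filter_not Finset.univ (fun i => e i < a)]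
  have h1 : b ^ r ≤ ∏ i with e i < a, e i := by
    rw [hr, ← Finset.prod_const]
    exact Finset.prod_le_prod (fun _ _ => hb.le) fun i _ => hbe i
  have h2 : a ^ (Fintype.card ι - r) ≤ ∏ i with ¬ e i < a, e i := by
    rw [← hcard, ← Finset.prod_const]
    refine Finset.prod_le_prod (fun _ _ => ha.le) fun i hi => ?_
    simpa using hi
  calc a ^ (Fintype.card ι - d) * b ^ d = a ^ (Fintype.card ι - d) * (b ^ (d - r) * b ^ r) := by
        rw [← pow_add, Nat.sub_add_cancel hd]
    _ ≤ a ^ (Fintype.card ι - d) * (a ^ (d - r) * b ^ r) := by gcongr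
    _ = b ^ r * a ^ (Fintype.card ι - r) := by
        rw [← mul_assoc, ← pow_add, show Fintype.card ι - d + (d - r) = Fintype.card ι - r by omega,
          mul_comm]
    _ ≤ _ := mul_le_mul h1 h2 (by positivity) ((pow_pos hb r).le.trans h1)

variable {k m n : ℕ} {P : Fin n → Matrix (Fin k) (Fin k) ℂ} {Q : Fin n → Matrix (Fin m) (Fin m) ℂ}

/-- On matrices of determinant of modulus one, `T ↦ det G_A(T^* T)` is coercive. -/
theorem exists_mul_norm_sq_le_norm_det (hk : 0 < k) {A : Matrix (Fin k × Fin m) (Fin k × Fin m) ℂ}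
    (hA : A = ∑ i, P i ⊗ₖ Q i) (hpsd : A.PosSemidef) (hG : (mapG P Q 1).PosDef)
    (hd : k * Module.finrank ℂ (LinearMap.ker A.mulVecLin) < m) :
    ∃ C : ℝ, 0 < C ∧ ∀ T : Matrix (Fin k) (Fin k) ℂ, ‖T.det‖ = 1 → ∀ i j,
      C * ‖T i j‖ ^ 2 ≤ ‖(mapG P Q (Tᴴ * T)).det‖ := by
  obtain ⟨l, hl, hgap⟩ := hpsd.exists_spectral_gap
  obtain ⟨c, hc, hcl, hGc⟩ := hG.exists_sub_smul_one_posSemidef l hl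
  set d := Module.finrank ℂ (LinearMap.ker A.mulVecLin) with hd_def
  -- The division by `k` pays for `‖T i j‖² ≤ tr(T^* T) ≤ k x_M`.
  refine ⟨l ^ (m - d) * c ^ d / k, ?_, fun T hT i j => ?_⟩
  · positivity
  have hkR : (0 : ℝ) < k := by exact_mod_cast hk
  have : Nonempty (Fin k) := ⟨i⟩
  obtain ⟨W, x, hW, hW', hX⟩ := (isHermitian_conjTranspose_mul_self T).exists_unitary_diagonal
  have hx0 : ∀ i, 0 ≤ x i := by
    have := posSemidef_conjTranspose_mul_self T
    rwa [hX, posSemidef_conj_diagonal_iff hW] at this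
  have hprod : ∏ i, x i = 1 := by
    have h : ‖(Tᴴ * T).det‖ = 1 := by simp [hT]
    rwa [hX, det_conj_diagonal hW, Complex.norm_real, Real.norm_eq_abs,
      abs_of_nonneg (Finset.prod_nonneg fun i _ => hx0 i)] at h
  obtain ⟨M, hM⟩ := Finite.exists_max x
  obtain ⟨μ, hμ⟩ := Finite.exists_min x
  have hxpos : ∀ i, 0 < x i := by
    have h1 : ∏ i, x i ≠ 0 := by rw [hprod]; exact one_ne_zero
    rw [Finset.prod_ne_zero_iff] at h1
    exact fun i => (hx0 i).lt_of_ne (h1 i (Finset.mem_univ _)).symm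
  have hprod_le : 1 ≤ x μ * x M ^ (k - 1) := by
    rw [← hprod, ← Finset.mul_prod_erase _ _ (Finset.mem_univ μ)]
    refine mul_le_mul_of_nonneg_left ?_ (hx0 μ)
    calc ∏ i ∈ Finset.univ.erase μ, x i ≤ ∏ _i ∈ Finset.univ.erase μ, x M :=
          Finset.prod_le_prod (fun i _ => hx0 i) fun i _ => hM i
      _ = x M ^ (k - 1) := by simp [Finset.card_erase_of_mem]
  have hM1 : 1 ≤ x M := by
    by_contra! h
    have : ∏ i, x i < 1 := by
      calc ∏ i, x i ≤ ∏ _i : Fin k, x M := Finset.prod_le_prod (fun i _ => hx0 i) fun i _ => hM i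
        _ = x M ^ k := by simp
        _ < 1 := pow_lt_one₀ (hx0 M) h hk.ne'
    exact this.ne hprod
  have hentry : ‖T i j‖ ^ 2 ≤ k * x M := by
    have htr : ∑ b, ∑ a, ‖T a b‖ ^ 2 = ∑ i, x i := by
      have h := congrArg trace hX
      rw [trace_conj_diagonal hW] at h
      simp only [trace, diag_apply, mul_apply, conjTranspose_apply, Complex.star_def,
        Complex.conj_mul'] at h
      exact_mod_cast h
    calc ‖T i j‖ ^ 2 ≤ ∑ a, ‖T a j‖ ^ 2 :=
          Finset.single_le_sum (f := fun a => ‖T a j‖ ^ 2) (fun a _ => by positivity)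
            (Finset.mem_univ i)
      _ ≤ ∑ b, ∑ a, ‖T a b‖ ^ 2 :=
          Finset.single_le_sum (f := fun b => ∑ a, ‖T a b‖ ^ 2) (fun a _ => by positivity)
            (Finset.mem_univ j)
      _ = ∑ i, x i := htr
      _ ≤ ∑ _i : Fin k, x M := Finset.sum_le_sum fun i _ => hM i
      _ = k * x M := by simp
  have hGX : (mapG P Q (Tᴴ * T)).PosSemidef :=
    mapG_posSemidef (hA ▸ hpsd) (posSemidef_conjTranspose_mul_self T)
  obtain ⟨U, e, hU, hU', hGU⟩ := hGX.isHermitian.exists_unitary_diagonal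
  have hcount : (Finset.univ.filter fun j => e j < x M * l).card ≤ d := by
    have hvv : vecMulVec (fun i => W i M) (star fun i => W i M) =
        W * diagonal (fun i => (((Pi.single M 1 : Fin k → ℝ) i : ℝ) : ℂ)) * Wᴴ := by
      ext a b
      rw [mul_apply, Finset.sum_eq_single M]
      · simp [vecMulVec_apply, mul_diagonal]
      · intro i _ hi
        simp [mul_diagonal, hi]
      · simp
    refine card_eigenvalue_lt_le hA hpsd hgap (v := fun i => W i M) ?_ (hxpos M) ?_ hU hGU
    · have := congrFun (congrFun hW M) M
      simpa [mul_apply, dotProduct] using this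
    · rw [hvv, hX, conj_diagonal_sub_smul, posSemidef_conj_diagonal_iff hW]
      intro i
      by_cases hi : i = M
      · subst hi
        simp
      · simp [hi, hx0 i]
  -- `G_A(T^* T) ≥ x_μ G_A(1) ≥ x_μ c`, by positivity of `G_A`.
  have hlower : ∀ j, x μ * c ≤ e j := by
    have h1 : (Tᴴ * T - (x μ : ℂ) • 1).PosSemidef := by
      have h := conj_diagonal_sub_smul W x 1 (x μ)
      simp only [Pi.one_apply, Complex.ofReal_one, diagonal_one, hW', ← hX,
        mul_one] at h
      rw [h, posSemidef_conj_diagonal_iff hW]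
      exact fun i => sub_nonneg.mpr (hμ i)
    have h2 := mapG_posSemidef (hA ▸ hpsd) h1
    rw [← mapGLin_apply, map_sub, map_smul, mapGLin_apply, mapGLin_apply] at h2
    have h3 := h2.add (hGc.smul (a := (x μ : ℂ)) (by exact_mod_cast hx0 μ))
    rw [smul_sub, smul_smul, sub_add_sub_cancel, ← Complex.ofReal_mul] at h3
    have h := conj_diagonal_sub_smul U e 1 (x μ * c)
    simp only [Pi.one_apply, Complex.ofReal_one, diagonal_one, hU', ← hGU,
      mul_one] at h
    rw [h, posSemidef_conj_diagonal_iff hU] at h3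
    exact fun j => sub_nonneg.mp (h3 j)
  have hdm : d ≤ m := (Nat.le_mul_of_pos_left d hk).trans hd.le
  have hab : x μ * c ≤ x M * l := mul_le_mul (hM μ) hcl hc.le (hx0 M)
  have hmain := pow_mul_pow_le_prod (mul_pos (hxpos μ) hc) hab hlower hcount
    (by rwa [Fintype.card_fin])
  rw [Fintype.card_fin] at hmain
  have hexp : m - d = (k - 1) * d + (m - k * d) := by
    obtain ⟨k', rfl⟩ : ∃ k', k = k' + 1 := ⟨k - 1, by omega⟩
    have : (k' + 1) * d = k' * d + d := by ring
    rw [Nat.add_sub_cancel]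
    omega
  -- The right side is `x_M^(m - k d) (x_μ x_M^(k-1))^d`, with `x_M ≥ 1` and `m - k d ≥ 1`.
  have hxx : x M ≤ x M ^ (m - d) * x μ ^ d := by
    calc x M = x M ^ 1 * 1 ^ d := by simp
      _ ≤ x M ^ (m - k * d) * (x μ * x M ^ (k - 1)) ^ d := by
        gcongr
        omega
      _ = _ := by rw [hexp, mul_pow, pow_add, ← pow_mul]; ring
  rw [hGU, det_conj_diagonal hU, Complex.norm_real]
  refine le_trans ?_ (hmain.trans (le_abs_self _))
  calc l ^ (m - d) * c ^ d / k * ‖T i j‖ ^ 2 ≤ l ^ (m - d) * c ^ d / k * (k * x M) := by gcongr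
    _ = l ^ (m - d) * c ^ d * x M := by field_simp
    _ ≤ l ^ (m - d) * c ^ d * (x M ^ (m - d) * x μ ^ d) := by gcongr
    _ = _ := by rw [mul_pow, mul_pow]; ring

end coercivity

/-! ### Existence of a minimiser and its first order condition -/

section scaling
open Matrix

/-- The arithmetic–geometric mean inequality for the eigenvalues. It replaces differentiation of a
determinant by that of a trace. -/
theorem Matrix.PosSemidef.norm_det_le {ι : Type*} [Fintype ι] [DecidableEq ι] [Nonempty ι]
    {H : Matrix ι ι ℂ} (hH : H.PosSemidef) :
    ‖H.det‖ ≤ (H.trace.re / Fintype.card ι) ^ Fintype.card ι := by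
  obtain ⟨U, e, h1, h2, h3⟩ := hH.isHermitian.exists_unitary_diagonal
  have he : ∀ i, 0 ≤ e i := by
    rwa [h3, posSemidef_conj_diagonal_iff h1] at hH
  rw [h3, det_conj_diagonal h1, trace_conj_diagonal h1, Complex.norm_real, Complex.ofReal_re,
    Real.norm_eq_abs, abs_of_nonneg (Finset.prod_nonneg fun i _ => he i)]
  have hc : (Fintype.card ι : ℝ) ≠ 0 := by exact_mod_cast Fintype.card_ne_zero
  have h := Real.geom_mean_le_arith_mean_weighted Finset.univ
    (fun _ : ι => ((Fintype.card ι : ℝ))⁻¹) e (fun _ _ => by positivity) (by simp [hc])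
    (fun i _ => he i)
  calc ∏ i, e i = (∏ i, e i ^ ((Fintype.card ι : ℝ))⁻¹) ^ Fintype.card ι := by
        rw [← Finset.prod_pow]
        exact Finset.prod_congr rfl fun i _ =>
          (Real.rpow_inv_natCast_pow (he i) Fintype.card_ne_zero).symm
    _ ≤ (∑ i, (Fintype.card ι : ℝ)⁻¹ * e i) ^ Fintype.card ι :=
        pow_le_pow_left₀ (Finset.prod_nonneg fun i _ => Real.rpow_nonneg (he i) _) h _
    _ = _ := by rw [← Finset.mul_sum, div_eq_inv_mul]

theorem Matrix.PosSemidef.exists_conj_eq_one {ι : Type*} [Fintype ι] [DecidableEq ι]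
    {H : Matrix ι ι ℂ} (hH : H.PosSemidef) (hdet : H.det ≠ 0) :
    ∃ V : Matrix ι ι ℂ, V * H * Vᴴ = 1 := by
  obtain ⟨U, e, h1, h2, h3⟩ := hH.isHermitian.exists_unitary_diagonal
  have he : ∀ i, 0 < e i := by
    rw [h3, posSemidef_conj_diagonal_iff h1] at hH
    rw [h3, det_conj_diagonal h1, Complex.ofReal_ne_zero, Finset.prod_ne_zero_iff] at hdet
    exact fun i => (hH i).lt_of_ne (hdet i (Finset.mem_univ _)).symm
  set D : Matrix ι ι ℂ := diagonal fun i => (((√(e i))⁻¹ : ℝ) : ℂ) with hD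
  have hDH : Dᴴ = D := by
    rw [hD, diagonal_conjTranspose]
    congr 1
    ext i
    simp
  refine ⟨D * Uᴴ, ?_⟩
  rw [conjTranspose_mul, conjTranspose_conjTranspose, hDH, h3,
    show D * Uᴴ * (U * diagonal (fun i => (e i : ℂ)) * Uᴴ) * (U * D) =
      D * (Uᴴ * U) * diagonal (fun i => (e i : ℂ)) * (Uᴴ * U) * D by simp only [Matrix.mul_assoc],
    h1, Matrix.mul_one, Matrix.mul_one, hD, diagonal_mul_diagonal, diagonal_mul_diagonal,
    ← diagonal_one]
  congr 1
  ext i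
  have hs : √(e i) ≠ 0 := (Real.sqrt_pos.mpr (he i)).ne'
  rw [← Complex.ofReal_mul, ← Complex.ofReal_mul]
  norm_cast
  nth_rewrite 2 [← Real.mul_self_sqrt (he i).le]
  field_simp

variable {k m n : ℕ} {P : Fin n → Matrix (Fin k) (Fin k) ℂ} {Q : Fin n → Matrix (Fin m) (Fin m) ℂ}

theorem sum_kronecker_swap (P : Fin n → Matrix (Fin k) (Fin k) ℂ)
    (Q : Fin n → Matrix (Fin m) (Fin m) ℂ) :
    ∑ i, Q i ⊗ₖ P i = (∑ i, P i ⊗ₖ Q i).submatrix Prod.swap Prod.swap := by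
  ext a b
  simp [Matrix.sum_apply, mul_comm]

/-- A coercive `T ↦ det G_A(T^* T)` attains its minimum on matrices of unimodular determinant. -/
theorem exists_minimizer_of_coercive (P : Fin n → Matrix (Fin k) (Fin k) ℂ)
    (Q : Fin n → Matrix (Fin m) (Fin m) ℂ) {C : ℝ} (hC : 0 < C)
    (hcoer : ∀ T : Matrix (Fin k) (Fin k) ℂ, ‖T.det‖ = 1 → ∀ i j,
      C * ‖T i j‖ ^ 2 ≤ ‖(mapG P Q (Tᴴ * T)).det‖) :
    ∃ U : Matrix (Fin k) (Fin k) ℂ, ‖U.det‖ = 1 ∧ ∀ T : Matrix (Fin k) (Fin k) ℂ, ‖T.det‖ = 1 →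
      ‖(mapG P Q (Uᴴ * U)).det‖ ≤ ‖(mapG P Q (Tᴴ * T)).det‖ := by
  set f : Matrix (Fin k) (Fin k) ℂ → ℝ := fun T => ‖(mapG P Q (Tᴴ * T)).det‖ with hf
  -- Coercivity bounds every entry of a competitor no worse than `T = 1` by this radius, so
  -- minimising over a compact set suffices.
  set K : Set (Matrix (Fin k) (Fin k) ℂ) := {T | ‖T.det‖ = 1} ∩
    Set.univ.pi fun _ => Set.univ.pi fun _ => Metric.closedBall 0 (√(f 1 / C)) with hK
  have hcont : Continuous f := by
    refine (Continuous.matrix_det ?_).norm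
    simp only [mapG]
    refine continuous_finsetSum _ fun i _ => ?_
    have h : Continuous fun T : Matrix (Fin k) (Fin k) ℂ => (P i * (Tᴴ * T)).trace :=
      (continuous_const.matrix_mul
        (continuous_id.matrix_conjTranspose.matrix_mul continuous_id)).matrix_trace
    exact h.smul continuous_const
  have hKc : IsCompact K := by
    refine IsCompact.inter_left ?_ (isClosed_eq continuous_id.matrix_det.norm continuous_const)
    exact isCompact_univ_pi fun _ => isCompact_univ_pi fun _ => isCompact_closedBall _ _
  have hmem : ∀ T : Matrix (Fin k) (Fin k) ℂ, ‖T.det‖ = 1 → f T ≤ f 1 → T ∈ K := by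
    refine fun T hT hle => ⟨hT, fun i _ j _ => ?_⟩
    rw [mem_closedBall_zero_iff]
    refine Real.le_sqrt_of_sq_le ?_
    rw [le_div_iff₀ hC, mul_comm]
    exact (hcoer T hT i j).trans hle
  obtain ⟨U, hU, hmin⟩ := hKc.exists_isMinOn ⟨1, hmem 1 (by simp) le_rfl⟩ hcont.continuousOn
  refine ⟨U, hU.1, fun T hT => ?_⟩
  rcases le_or_gt (f T) (f 1) with h | h
  · exact hmin (hmem T hT h)
  · exact (hmin (hmem 1 (by simp) le_rfl)).trans h.le

/-- The homogeneous form of minimality on matrices of unimodular determinant. -/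
theorem pow_mul_norm_det_pow_le (hk : 0 < k) (hm : 0 < m) {a : ℝ} (ha : 0 ≤ a)
    (hmin : ∀ T : Matrix (Fin k) (Fin k) ℂ, ‖T.det‖ = 1 → a ≤ ‖(mapG P Q (Tᴴ * T)).det‖)
    (T : Matrix (Fin k) (Fin k) ℂ) :
    a ^ k * ‖T.det‖ ^ (2 * m) ≤ ‖(mapG P Q (Tᴴ * T)).det‖ ^ k := by
  rcases (norm_nonneg T.det).eq_or_lt with h0 | hpos
  · rw [← h0, zero_pow (by omega), mul_zero]
    positivity
  -- `T / r` is admissible, and the substitution divides `det G_A(T^* T)` by `r^(2m)`; the `k`-th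
  -- power removes the root.
  set r : ℝ := ‖T.det‖ ^ ((k : ℝ)⁻¹) with hr
  have hrk : r ^ k = ‖T.det‖ := Real.rpow_inv_natCast_pow hpos.le hk.ne'
  have hrpos : 0 < r := Real.rpow_pos_of_pos hpos _
  have h := hmin (((r⁻¹ : ℝ) : ℂ) • T) (by
    rw [det_smul, Fintype.card_fin, norm_mul, norm_pow, Complex.norm_real, Real.norm_eq_abs,
      abs_of_pos (inv_pos.mpr hrpos), inv_pow, hrk, inv_mul_cancel₀ hpos.ne'])
  rw [conjTranspose_smul, Matrix.smul_mul, Matrix.mul_smul, smul_smul, ← mapGLin_apply, map_smul,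
    det_smul, Fintype.card_fin, norm_mul, norm_pow, norm_mul, norm_star, Complex.norm_real,
    Real.norm_eq_abs, abs_of_pos (inv_pos.mpr hrpos), mapGLin_apply] at h
  have h2 : a * r ^ (2 * m) ≤ ‖(mapG P Q (Tᴴ * T)).det‖ := by
    calc a * r ^ (2 * m) ≤ (r⁻¹ * r⁻¹) ^ m * ‖(mapG P Q (Tᴴ * T)).det‖ * r ^ (2 * m) := by gcongr
      _ = ‖(mapG P Q (Tᴴ * T)).det‖ := by
        rw [pow_mul, mul_right_comm, ← mul_pow]
        have : r⁻¹ * r⁻¹ * r ^ 2 = 1 := by field_simp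
        rw [this, one_pow, one_mul]
  calc a ^ k * ‖T.det‖ ^ (2 * m) = (a * r ^ (2 * m)) ^ k := by rw [← hrk]; ring
    _ ≤ _ := pow_le_pow_left₀ (by positivity) h2 k

/-- First order condition at a minimum. -/
theorem mapF_one_eq_of_extremal (hk : 0 < k) (hm : 0 < m)
    (hpsd : (∑ i, P i ⊗ₖ Q i).PosSemidef) (hG : mapG P Q 1 = 1)
    (hext : ∀ S : Matrix (Fin k) (Fin k) ℂ,
      ‖S.det‖ ^ (2 * m) ≤ ‖(mapG P Q (Sᴴ * S)).det‖ ^ k) :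
    mapF P Q 1 = ((m / k : ℝ) : ℂ) • 1 := by
  have hmR : (0 : ℝ) < m := by exact_mod_cast hm
  have hkR : (0 : ℝ) < k := by exact_mod_cast hk
  have : Nonempty (Fin m) := ⟨⟨0, hm⟩⟩
  have hFpsd : (mapG Q P 1).PosSemidef := by
    refine mapG_posSemidef ?_ PosSemidef.one
    rw [sum_kronecker_swap]
    exact hpsd.submatrix _
  change mapG Q P 1 = _
  obtain ⟨W, σ, hW, hW', hF⟩ := hFpsd.isHermitian.exists_unitary_diagonal
  suffices hσ : ∀ j, σ j = m / k by
    rw [hF, show σ = fun _ => (m / k : ℝ) from funext hσ, ← smul_one_eq_diagonal, Matrix.mul_smul,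
      Matrix.mul_one, Matrix.smul_mul, hW']
  intro j
  -- Test with `S` stretching the `j`-th eigenvector of `F_A(1)` by `1 + s`: then `S^* S = 1 + (2s +
  -- s²) E` with `E` its projection, and `tr G_A(E) = tr(E F_A(1)) = σ j`.
  have key : ∀ s : ℝ, (1 + s) ^ 2 ≤ (1 + (2 * s + s ^ 2) * (σ j / m)) ^ k := by
    intro s
    set w : Fin k → ℝ := fun i => 1 + s * (Pi.single j 1 : Fin k → ℝ) i with hw
    set S := diagonal (fun i => (w i : ℂ)) * Wᴴ with hS
    have hSdet : ‖S.det‖ = |1 + s| := by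
      have h1 : ‖W.det‖ = 1 := by
        have h := congrArg (‖·.det‖) hW
        simp only [det_mul, det_conjTranspose, norm_mul, norm_star, det_one, norm_one] at h
        nlinarith [norm_nonneg W.det]
      have h2 : ∏ i, w i = 1 + s := by
        rw [Finset.prod_eq_single j]
        · simp [hw]
        · intro i _ hi
          simp [hw, hi]
        · simp
      rw [hS, det_mul, det_conjTranspose, norm_mul, norm_star, h1, mul_one, det_diagonal,
        ← Complex.ofReal_prod, h2, Complex.norm_real, Real.norm_eq_abs]
    set E := W * diagonal (fun i => (((Pi.single j 1 : Fin k → ℝ) i : ℝ) : ℂ)) * Wᴴ with hE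
    have hSS : Sᴴ * S = 1 + ((2 * s + s ^ 2 : ℝ) : ℂ) • E := by
      have h := conj_diagonal_sub_smul W 1 (Pi.single j 1) (-(2 * s + s ^ 2))
      simp only [Pi.one_apply, Complex.ofReal_one, diagonal_one, Matrix.mul_one, hW',
        Complex.ofReal_neg, neg_smul, sub_neg_eq_add] at h
      rw [hE, h, hS, conjTranspose_mul, conjTranspose_conjTranspose, diagonal_conjTranspose,
        ← Matrix.mul_assoc, Matrix.mul_assoc W, diagonal_mul_diagonal]
      congr 3
      ext i
      by_cases hi : i = j
      · subst hi
        simp [hw]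
        ring
      · simp [hw, hi]
    have htrE : (mapG P Q E).trace = σ j := by
      have h := trace_mul_mapG P Q E 1
      rw [Matrix.one_mul] at h
      rw [h, hF, hE, show W * diagonal (fun i => (((Pi.single j 1 : Fin k → ℝ) i : ℝ) : ℂ)) * Wᴴ *
        (W * diagonal (fun i => (σ i : ℂ)) * Wᴴ) = W * (diagonal
          (fun i => (((Pi.single j 1 : Fin k → ℝ) i : ℝ) : ℂ)) * (Wᴴ * W) *
          diagonal (fun i => (σ i : ℂ))) * Wᴴ by simp only [Matrix.mul_assoc], hW, Matrix.mul_one,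
        diagonal_mul_diagonal, trace_mul_comm, ← Matrix.mul_assoc, hW, Matrix.one_mul,
        trace_diagonal, Finset.sum_eq_single j]
      · simp
      · intro i _ hi
        simp [hi]
      · simp
    have hpos := mapG_posSemidef hpsd (posSemidef_conjTranspose_mul_self S)
    have htr : (mapG P Q (Sᴴ * S)).trace = ((m + (2 * s + s ^ 2) * σ j : ℝ) : ℂ) := by
      rw [hSS, ← mapGLin_apply, map_add, map_smul, mapGLin_apply, mapGLin_apply, hG, trace_add,
        trace_smul, htrE, trace_one, Fintype.card_fin]
      push_cast
      simp
    have hdet := hpos.norm_det_le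
    rw [htr, Complex.ofReal_re, Fintype.card_fin,
      show (m + (2 * s + s ^ 2) * σ j) / m = 1 + (2 * s + s ^ 2) * (σ j / m) by field_simp] at hdet
    have hnn : 0 ≤ 1 + (2 * s + s ^ 2) * (σ j / m) := by
      have h := hpos.trace_nonneg
      rw [htr] at h
      have h' : 0 ≤ m + (2 * s + s ^ 2) * σ j := by exact_mod_cast h
      rw [show 1 + (2 * s + s ^ 2) * (σ j / m) = (m + (2 * s + s ^ 2) * σ j) / m by field_simp]
      positivity
    refine le_of_pow_le_pow_left₀ hm.ne' (by positivity) ?_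
    calc ((1 + s) ^ 2) ^ m = ‖S.det‖ ^ (2 * m) := by rw [hSdet, pow_mul, sq_abs]
      _ ≤ _ := hext S
      _ ≤ ((1 + (2 * s + s ^ 2) * (σ j / m)) ^ m) ^ k :=
          pow_le_pow_left₀ (norm_nonneg _) hdet k
      _ = _ := by rw [← pow_mul, ← pow_mul, mul_comm m k]
  -- Equality holds at `s = 0`, so the derivative `2 k σ j / m - 2` vanishes.
  have hmin : IsLocalMin (fun s : ℝ => (1 + (2 * s + s ^ 2) * (σ j / m)) ^ k - (1 + s) ^ 2) 0 := by
    refine Filter.Eventually.of_forall fun s => ?_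
    have := key s
    simpa using this
  have hder : HasDerivAt (fun s : ℝ => (1 + (2 * s + s ^ 2) * (σ j / m)) ^ k - (1 + s) ^ 2)
      (k * (2 * (σ j / m)) - 2) 0 := by
    have h1 : HasDerivAt (fun s : ℝ => 1 + (2 * s + s ^ 2) * (σ j / m)) (2 * (σ j / m)) 0 := by
      exact (((((hasDerivAt_id (0 : ℝ)).const_mul 2).add
        ((hasDerivAt_id (0 : ℝ)).pow 2)).mul_const (σ j / m)).const_add 1).congr_deriv (by simp)
    have h2 : HasDerivAt (fun s : ℝ => (1 + s) ^ 2) 2 0 := by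
      exact (((hasDerivAt_id (0 : ℝ)).const_add 1).pow 2).congr_deriv (by simp)
    exact ((h1.pow k).sub h2).congr_deriv (by simp)
  have h0 := hmin.hasDerivAt_eq_zero hder
  field_simp at h0 ⊢
  linarith

/-- Operator scaling: `A` can be brought to a form with scalar partial traces. -/
theorem exists_scaling (hk : 0 < k) (hm : 0 < m) (hpsd : (∑ i, P i ⊗ₖ Q i).PosSemidef)
    (hG : (mapG P Q 1).PosDef)
    (hd : k * Module.finrank ℂ (LinearMap.ker (∑ i, P i ⊗ₖ Q i).mulVecLin) < m) :
    ∃ (U : Matrix (Fin k) (Fin k) ℂ) (V : Matrix (Fin m) (Fin m) ℂ), IsUnit U ∧ IsUnit V ∧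
      mapG (fun i => U * P i * Uᴴ) (fun i => V * Q i * Vᴴ) 1 = 1 ∧
      mapF (fun i => U * P i * Uᴴ) (fun i => V * Q i * Vᴴ) 1 = ((m / k : ℝ) : ℂ) • 1 := by
  obtain ⟨C, hC, hcoer⟩ := exists_mul_norm_sq_le_norm_det hk rfl hpsd hG hd
  obtain ⟨U, hU, hmin⟩ := exists_minimizer_of_coercive P Q hC hcoer
  -- If the minimum were `0`, coercivity would force `U = 0`, against `|det U| = 1`.
  have hdet : (mapG P Q (Uᴴ * U)).det ≠ 0 := by
    intro h0
    have hU0 : U = 0 := by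
      ext i j
      have h := hcoer U hU i j
      rw [h0, norm_zero] at h
      have : ‖U i j‖ ^ 2 ≤ 0 := nonpos_of_mul_nonpos_right h hC
      simpa using this
    have : Nonempty (Fin k) := ⟨⟨0, hk⟩⟩
    simp [hU0] at hU
  obtain ⟨V, hV⟩ := (mapG_posSemidef hpsd (posSemidef_conjTranspose_mul_self U)).exists_conj_eq_one
    hdet
  have hG1 : mapG (fun i => U * P i * Uᴴ) (fun i => V * Q i * Vᴴ) 1 = 1 := by
    rw [mapG_conj, Matrix.mul_one, hV]
  refine ⟨U, V, ?_, ?_, hG1, mapF_one_eq_of_extremal hk hm ?_ hG1 fun S => ?_⟩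
  · rw [isUnit_iff_isUnit_det, isUnit_iff_ne_zero, ← norm_ne_zero_iff, hU]
    exact one_ne_zero
  · rw [isUnit_iff_isUnit_det, isUnit_iff_ne_zero]
    intro h0
    have := congrArg det hV
    simp [h0] at this
  · rw [← sum_kronecker_conj]
    exact hpsd.mul_mul_conjTranspose_same _
  · have h := pow_mul_norm_det_pow_le hk hm (norm_nonneg _) hmin (S * U)
    have hV' : ‖V.det‖ * ‖(mapG P Q (Uᴴ * U)).det‖ * ‖V.det‖ = 1 := by
      have := congrArg (‖·.det‖) hV
      simpa using this
    rw [mapG_conj, show Uᴴ * (Sᴴ * S) * U = (S * U)ᴴ * (S * U) by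
      rw [conjTranspose_mul]; simp only [Matrix.mul_assoc]]
    simp only [det_mul, det_conjTranspose, norm_mul, norm_star] at h ⊢
    rw [hU, mul_one] at h
    calc ‖S.det‖ ^ (2 * m) = (‖V.det‖ * ‖(mapG P Q (Uᴴ * U)).det‖ * ‖V.det‖) ^ k *
          ‖S.det‖ ^ (2 * m) := by rw [hV', one_pow, one_mul]
      _ = (‖V.det‖ * ‖V.det‖) ^ k * (‖(mapG P Q (Uᴴ * U)).det‖ ^ k * ‖S.det‖ ^ (2 * m)) := by ring
      _ ≤ (‖V.det‖ * ‖V.det‖) ^ k * ‖(mapG P Q ((S * U)ᴴ * (S * U))).det‖ ^ k := by gcongr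
      _ = _ := by ring

end scaling

/-! ### Operator Schmidt decomposition with scalar partial traces -/

section schmidt
open Matrix

/-- The real space of traceless Hermitian matrices. -/
def tracelessHermitian (k : ℕ) : Submodule ℝ (Matrix (Fin k) (Fin k) ℂ) where
  carrier := {X | X.IsHermitian ∧ X.trace = 0}
  add_mem' hX hY := ⟨hX.1.add hY.1, by rw [trace_add, hX.2, hY.2, add_zero]⟩
  zero_mem' := ⟨isHermitian_zero, trace_zero _ _⟩
  smul_mem' c X hX := ⟨by
    change (c • X)ᴴ = c • X
    rw [conjTranspose_smul, hX.1.eq, star_trivial], by rw [trace_smul, hX.2, smul_zero]⟩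

theorem Matrix.IsHermitian.ofReal_re_trace_mul {ι : Type*} [Fintype ι] {X Y : Matrix ι ι ℂ}
    (hX : X.IsHermitian) (hY : Y.IsHermitian) : (((X * Y).trace.re : ℝ) : ℂ) = (X * Y).trace := by
  rw [← Complex.conj_eq_iff_re, ← Complex.star_def, ← trace_conjTranspose, conjTranspose_mul, hX.eq,
    hY.eq, trace_mul_comm]

/-- The trace inner product on traceless Hermitian matrices. -/
@[reducible]
noncomputable def tracelessHermitianCore (k : ℕ) :
    InnerProductSpace.Core ℝ (tracelessHermitian k) where
  inner X Y := ((X : Matrix (Fin k) (Fin k) ℂ) * (Y : Matrix (Fin k) (Fin k) ℂ)).trace.re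
  conj_inner_symm X Y := by
    rw [trace_mul_comm]
    rfl
  re_inner_nonneg X := by
    have h := (posSemidef_conjTranspose_mul_self (X : Matrix (Fin k) (Fin k) ℂ)).trace_nonneg
    rw [X.2.1.eq] at h
    exact (Complex.le_def.mp h).1
  add_left X Y Z := by
    simp [Matrix.add_mul]
  smul_left X Y r := by
    simp
  definite X h := by
    have h2 : ((X : Matrix (Fin k) (Fin k) ℂ)ᴴ * (X : Matrix (Fin k) (Fin k) ℂ)).trace = 0 := by
      rw [X.2.1.eq, ← IsHermitian.ofReal_re_trace_mul X.2.1 X.2.1]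
      exact congrArg Complex.ofReal h
    exact Subtype.ext (trace_conjTranspose_mul_self_eq_zero_iff.mp h2)

/-- A trace-symmetric Hermiticity-preserving map on traceless matrices is diagonalized by
a Hermitian basis. -/
theorem exists_traceless_eigenbasis {k : ℕ}
    (L : Matrix (Fin k) (Fin k) ℂ →ₗ[ℂ] Matrix (Fin k) (Fin k) ℂ)
    (hL : ∀ X, X.IsHermitian → (L X).IsHermitian) (htr : ∀ X, X.trace = 0 → (L X).trace = 0)
    (hsym : ∀ X Y, (L X * Y).trace = (X * L Y).trace) :
    ∃ (N : ℕ) (g : Fin N → Matrix (Fin k) (Fin k) ℂ), (∀ i, g i ∈ tracelessHermitian k) ∧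
      (∀ i j, (g i * g j).trace = if i = j then 1 else 0) ∧
      (∀ X ∈ tracelessHermitian k, X = ∑ i, (X * g i).trace • g i) ∧
      ∀ i, ∃ μ : ℂ, L (g i) = μ • g i := by
  let := (tracelessHermitianCore k).toNormedAddCommGroup
  let : InnerProductSpace ℝ (tracelessHermitian k) :=
    InnerProductSpace.ofCore (tracelessHermitianCore k).toCore
  have hinner (X Y : tracelessHermitian k) : inner ℝ X Y =
    ((X : Matrix (Fin k) (Fin k) ℂ) * (Y : Matrix (Fin k) (Fin k) ℂ)).trace.re := rfl
  let T : tracelessHermitian k →ₗ[ℝ] tracelessHermitian k :=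
    (L.restrictScalars ℝ).restrict (p := tracelessHermitian k) (q := tracelessHermitian k)
      fun X hX => ⟨hL X hX.1, htr X hX.2⟩
  have hT : T.IsSymmetric := fun X Y => congrArg Complex.re (hsym X Y)
  have hfin : FiniteDimensional ℝ (tracelessHermitian k) := inferInstance
  let b := hT.eigenvectorBasis rfl
  refine ⟨_, fun i => b i, fun i => (b i).2, fun i j => ?_, fun X hX => ?_, fun i => ?_⟩
  · rw [← IsHermitian.ofReal_re_trace_mul (b i).2.1 (b j).2.1, ← hinner,
      orthonormal_iff_ite.mp b.orthonormal i j]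
    split_ifs <;> simp
  · have h := congrArg (Subtype.val) (b.sum_repr' ⟨X, hX⟩)
    rw [Submodule.coe_sum] at h
    refine h.symm.trans (Finset.sum_congr rfl fun i _ => ?_)
    rw [← IsHermitian.ofReal_re_trace_mul hX.1 (b i).2.1, trace_mul_comm, Complex.coe_smul, hinner]
    rfl
  · refine ⟨(hT.eigenvalues rfl i : ℂ), ?_⟩
    have h := congrArg Subtype.val (hT.apply_eigenvectorBasis rfl i)
    exact h

/-- Extending by the identity one gets an orthonormal Hermitian eigenbasis of all matrices. -/
theorem exists_hermitian_eigenbasis {k : ℕ} (hk : 0 < k)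
    (L : Matrix (Fin k) (Fin k) ℂ →ₗ[ℂ] Matrix (Fin k) (Fin k) ℂ)
    (hL : ∀ X, X.IsHermitian → (L X).IsHermitian) (h1 : ∃ μ : ℂ, L 1 = μ • 1)
    (hsym : ∀ X Y, (L X * Y).trace = (X * L Y).trace) :
    ∃ (N : ℕ) (c : Option (Fin N) → Matrix (Fin k) (Fin k) ℂ),
      c none = (((Real.sqrt k : ℝ) : ℂ)⁻¹) • 1 ∧ (∀ o, (c o).IsHermitian) ∧
      (∀ o o', o ≠ o' → (c o * c o').trace = 0) ∧
      (∀ X, X = ∑ o, (X * c o).trace • c o) ∧ ∀ o, ∃ μ : ℂ, L (c o) = μ • c o := by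
  obtain ⟨μ, hμ⟩ := h1
  -- Traceless matrices are the orthogonal complement of the eigenvector `1` of the symmetric map
  -- `L`.
  have htr : ∀ X, X.trace = 0 → (L X).trace = 0 := by
    intro X hX
    rw [← Matrix.mul_one (L X), hsym, hμ, Matrix.mul_smul, Matrix.mul_one, trace_smul, hX,
      smul_zero]
  obtain ⟨N, g, hg, horth, hexp, heig⟩ := exists_traceless_eigenbasis L hL htr hsym
  have hkC : (k : ℂ) ≠ 0 := by exact_mod_cast hk.ne'
  have hs : (((Real.sqrt k : ℝ) : ℂ)⁻¹) * (((Real.sqrt k : ℝ) : ℂ)⁻¹) = (k : ℂ)⁻¹ := by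
    rw [← mul_inv, ← Complex.ofReal_mul, Real.mul_self_sqrt (Nat.cast_nonneg k),
      Complex.ofReal_natCast]
  refine ⟨N, fun o => o.elim ((((Real.sqrt k : ℝ) : ℂ)⁻¹) • 1) g, rfl, ?_, ?_, ?_, ?_⟩
  · rintro (_ | i)
    · change ((((Real.sqrt k : ℝ) : ℂ)⁻¹) • (1 : Matrix (Fin k) (Fin k) ℂ))ᴴ = _
      rw [conjTranspose_smul, conjTranspose_one, star_inv₀, Complex.star_def, Complex.conj_ofReal]
      rfl
    · exact (hg i).1
  · rintro (_ | i) (_ | j) hij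
    · exact absurd rfl hij
    · simp [(hg j).2]
    · simp [(hg i).2]
    · have : i ≠ j := fun h => hij (by rw [h])
      simp [horth, this]
  · have hherm : ∀ X : Matrix (Fin k) (Fin k) ℂ, X.IsHermitian →
        X = ((k : ℂ)⁻¹ * X.trace) • 1 + ∑ i, (X * g i).trace • g i := by
      intro X hX
      have hreal : star ((k : ℂ)⁻¹ * X.trace) = (k : ℂ)⁻¹ * X.trace := by
        rw [star_mul', ← trace_conjTranspose, hX.eq, star_inv₀, star_natCast]
      have hmem : X - ((k : ℂ)⁻¹ * X.trace) • 1 ∈ tracelessHermitian k := by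
        constructor
        · change (X - ((k : ℂ)⁻¹ * X.trace) • 1)ᴴ = _
          rw [conjTranspose_sub, conjTranspose_smul, hreal, conjTranspose_one, hX.eq]
        · rw [trace_sub, trace_smul, trace_one, Fintype.card_fin, smul_eq_mul]
          field_simp
          ring
      have h := hexp _ hmem
      have h' : ∀ i, ((X - ((k : ℂ)⁻¹ * X.trace) • 1) * g i).trace = (X * g i).trace := by
        intro i
        rw [Matrix.sub_mul, Matrix.smul_mul, Matrix.one_mul, trace_sub, trace_smul, (hg i).2,
          smul_zero, sub_zero]
      simp only [h'] at h
      rw [← h, add_sub_cancel]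
    intro X
    -- The expansion is known for Hermitian `X`; complex linearity extends it through real and
    -- imaginary parts.
    let Φ : Matrix (Fin k) (Fin k) ℂ →ₗ[ℂ] Matrix (Fin k) (Fin k) ℂ :=
      { toFun := fun X => ((k : ℂ)⁻¹ * X.trace) • 1 + ∑ i, (X * g i).trace • g i
        map_add' := fun X Y => by
          simp only [trace_add, Matrix.add_mul, add_smul, mul_add, Finset.sum_add_distrib]
          abel
        map_smul' := fun c X => by
          simp only [trace_smul, Matrix.smul_mul, smul_eq_mul, Finset.smul_sum, smul_add,
            smul_smul, RingHom.id_apply, mul_left_comm] }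
    have hΦ : ∀ X : Matrix (Fin k) (Fin k) ℂ, X.IsHermitian → Φ X = X := fun X hX => (hherm X hX).symm
    have hX : Φ X = X := by
      rw [← realPart_add_I_smul_imaginaryPart X, map_add, map_smul, hΦ _ (realPart X).2,
        hΦ _ (imaginaryPart X).2]
    rw [Fintype.sum_option]
    simp only [Option.elim]
    rw [Matrix.mul_smul, Matrix.mul_one, trace_smul, smul_smul, smul_eq_mul, mul_right_comm, hs]
    exact hX.symm
  · rintro (_ | i)
    · exact ⟨μ, by simp only [Option.elim]; rw [map_smul, hμ, smul_comm]⟩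
    · exact heig i

variable {k m n : ℕ} {P : Fin n → Matrix (Fin k) (Fin k) ℂ} {Q : Fin n → Matrix (Fin m) (Fin m) ℂ}

theorem mapG_isHermitian (hB : (∑ i, P i ⊗ₖ Q i).IsHermitian) {X : Matrix (Fin k) (Fin k) ℂ}
    (hX : X.IsHermitian) : (mapG P Q X).IsHermitian := by
  ext b b'
  rw [conjTranspose_apply, mapG_apply_eq, mapG_apply_eq, star_sum, Finset.sum_comm]
  simp only [star_sum, star_mul']
  rw [Finset.sum_comm]
  conv_lhs => rw [Finset.sum_comm]
  refine Finset.sum_congr rfl fun a _ => Finset.sum_congr rfl fun a' _ => ?_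
  rw [hB.apply, hX.apply]

/-- An orthogonal family in the span of `n` vectors, reindexed by `Fin n` with a prescribed
nonzero member at the first place. -/
theorem exists_embedding_of_trace_orthogonal {ι : Type*} [Fintype ι]
    {d : ι → Matrix (Fin m) (Fin m) ℂ} (hself : ∀ o, d o ≠ 0 → (d o * d o).trace ≠ 0)
    (horth : ∀ o o', o ≠ o' → (d o * d o').trace = 0)
    (hspan : ∀ o, d o ∈ Submodule.span ℂ (Set.range Q)) (o₀ : ι) (h₀ : d o₀ ≠ 0) :
    ∃ (h : 0 < n) (e : {o // d o ≠ 0} ↪ Fin n), e ⟨o₀, h₀⟩ = ⟨0, h⟩ := by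
  classical
  have hli : LinearIndependent ℂ fun j : {o // d o ≠ 0} => d j := by
    rw [Fintype.linearIndependent_iff]
    intro g hg j
    have h := congrArg (fun M => (M * d j).trace) hg
    simp only [Matrix.sum_mul, Matrix.smul_mul, trace_sum, trace_smul, Matrix.zero_mul, trace_zero,
      smul_eq_mul] at h
    rw [Finset.sum_eq_single j] at h
    · exact (mul_eq_zero.mp h).resolve_right (hself j j.2)
    · intro i _ hi
      rw [horth _ _ (fun h => hi (Subtype.ext h)), mul_zero]
    · simp
  have hcard : Fintype.card {o // d o ≠ 0} ≤ n := by
    have h := linearIndependent_le_span' _ hli (Set.range Q) (by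
      rintro _ ⟨j, rfl⟩
      exact hspan j)
    rw [Cardinal.mk_fintype, Nat.cast_le] at h
    exact h.trans ((Fintype.card_range_le Q).trans_eq (Fintype.card_fin n))
  have hn : 0 < n := (Fintype.card_pos_iff.mpr ⟨⟨o₀, h₀⟩⟩).trans_le hcard
  obtain ⟨e⟩ : Nonempty ({o // d o ≠ 0} ↪ Fin n) :=
    Function.Embedding.nonempty_of_card_le (by rwa [Fintype.card_fin])
  -- A transposition moves the prescribed member to index `0`.
  exact ⟨hn, e.trans (Equiv.swap (e ⟨o₀, h₀⟩) ⟨0, hn⟩).toEmbedding, by simp⟩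

/-- The operator Schmidt decomposition of a Hermitian `A` with scalar partial traces. -/
theorem exists_schmidt (hk : 0 < k) (hm : 0 < m) (hB : (∑ i, P i ⊗ₖ Q i).IsHermitian)
    (hG : mapG P Q 1 = ((√(k / m) : ℝ) : ℂ) • 1) (hF : mapF P Q 1 = ((√(m / k) : ℝ) : ℂ) • 1) :
    ∃ (C : Fin n → Matrix (Fin k) (Fin k) ℂ) (D : Fin n → Matrix (Fin m) (Fin m) ℂ),
      ∑ i, P i ⊗ₖ Q i = ∑ i, C i ⊗ₖ D i ∧
      (∃ h : 0 < n,
        C ⟨0, h⟩ = (((Real.sqrt k : ℝ) : ℂ)⁻¹) • (1 : Matrix (Fin k) (Fin k) ℂ) ∧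
        D ⟨0, h⟩ = (((Real.sqrt m : ℝ) : ℂ)⁻¹) • (1 : Matrix (Fin m) (Fin m) ℂ)) ∧
      ∀ i j, i ≠ j → (C i * C j).trace = 0 ∧ (D i * D j).trace = 0 := by
  classical
  have hF' : mapG Q P 1 = ((√(m / k) : ℝ) : ℂ) • 1 := hF
  have hB' : (∑ i, Q i ⊗ₖ P i).IsHermitian := by
    rw [sum_kronecker_swap]
    exact hB.submatrix _
  have hskC : ((√k : ℝ) : ℂ) ≠ 0 := by
    rw [Complex.ofReal_ne_zero]
    exact (Real.sqrt_pos.mpr (by exact_mod_cast hk)).ne'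
  have hsmC : ((√m : ℝ) : ℂ) ≠ 0 := by
    rw [Complex.ofReal_ne_zero]
    exact (Real.sqrt_pos.mpr (by exact_mod_cast hm)).ne'
  obtain ⟨N, c, hc0, hcH, hcorth, hcexp, hceig⟩ :=
    exists_hermitian_eigenbasis hk (mapGLin Q P ∘ₗ mapGLin P Q)
      (fun X hX => mapG_isHermitian hB' (mapG_isHermitian hB hX))
      ⟨((√(m / k) : ℝ) : ℂ) * ((√(k / m) : ℝ) : ℂ), by
        rw [LinearMap.comp_apply, mapGLin_apply P, hG, map_smul, mapGLin_apply, hF', smul_smul,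
          mul_comm]⟩
      (fun X Y => by
        simp only [LinearMap.comp_apply, mapGLin_apply]
        rw [trace_mul_comm, ← trace_mul_mapG P Q Y, ← trace_mul_mapG P Q X, trace_mul_comm])
  set d : Option (Fin N) → Matrix (Fin m) (Fin m) ℂ := fun o => mapG P Q (c o) with hd
  have hdH : ∀ o, (d o).IsHermitian := fun o => mapG_isHermitian hB (hcH o)
  -- The scalar `√(k/m)` in `hG` is the one that turns `1/√k` into `1/√m`.
  have hd0 : d none = (((√m : ℝ) : ℂ)⁻¹) • 1 := by
    have h := map_smul (mapGLin P Q) (((√k : ℝ) : ℂ)⁻¹) 1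
    rw [mapGLin_apply, mapGLin_apply, hG, ← hc0, smul_smul, Real.sqrt_div (Nat.cast_nonneg k),
      Complex.ofReal_div, inv_mul_eq_div, div_div_cancel_left' hskC] at h
    exact h
  -- The bilinear form `tr(XY)` is definite only on Hermitian matrices, hence the need for a
  -- Hermitian basis.
  have hdself : ∀ o, d o ≠ 0 → (d o * d o).trace ≠ 0 := by
    intro o ho h
    nth_rewrite 1 [← (hdH o).eq] at h
    exact ho (trace_conjTranspose_mul_self_eq_zero_iff.mp h)
  have hdorth : ∀ o o', o ≠ o' → (d o * d o').trace = 0 := by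
    intro o o' hne
    obtain ⟨μ, hμ⟩ := hceig o
    rw [LinearMap.comp_apply, mapGLin_apply, mapGLin_apply] at hμ
    -- By adjointness this is `tr(c o' · F_A(G_A(c o)))`, a multiple of `tr(c o' · c o)`.
    change (d o * mapG P Q (c o')).trace = 0
    rw [trace_mul_mapG, hμ, Matrix.mul_smul, trace_smul, hcorth _ _ hne.symm, smul_zero]
  have hdspan : ∀ o, d o ∈ Submodule.span ℂ (Set.range Q) := fun o =>
    Submodule.sum_mem _ fun i _ => Submodule.smul_mem _ _ (Submodule.subset_span ⟨i, rfl⟩)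
  have : Nonempty (Fin m) := ⟨⟨0, hm⟩⟩
  obtain ⟨hn, e, he⟩ := exists_embedding_of_trace_orthogonal hdself hdorth hdspan none (by
    rw [hd0]
    exact smul_ne_zero (inv_ne_zero hsmC) one_ne_zero)
  -- Unused indices are padded with zeros, which leaves the sum and the orthogonality intact.
  set C : Fin n → Matrix (Fin k) (Fin k) ℂ := Function.extend e (fun j => c j) 0 with hC
  set D : Fin n → Matrix (Fin m) (Fin m) ℂ := Function.extend e (fun j => d j) 0 with hD
  have hCe : ∀ j, C (e j) = c j := fun j => e.injective.extend_apply _ _ j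
  have hDe : ∀ j, D (e j) = d j := fun j => e.injective.extend_apply _ _ j
  have hCn : ∀ i, i ∉ Set.range e → C i = 0 := fun i hi => Function.extend_apply' _ _ _ hi
  have hDn : ∀ i, i ∉ Set.range e → D i = 0 := fun i hi => Function.extend_apply' _ _ _ hi
  refine ⟨C, D, ?_, ⟨hn, ?_, ?_⟩, fun i j hij => ?_⟩
  · calc ∑ i, P i ⊗ₖ Q i = ∑ i, ∑ o, c o ⊗ₖ ((P i * c o).trace • Q i) := by
          refine Finset.sum_congr rfl fun i _ => ?_
          conv_lhs => rw [hcexp (P i)]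
          ext a b
          simp only [kroneckerMap_apply, Matrix.sum_apply, Matrix.smul_apply, Finset.sum_mul,
            smul_eq_mul]
          exact Finset.sum_congr rfl fun o _ => by ring
      _ = ∑ o, c o ⊗ₖ d o := by
          rw [Finset.sum_comm]
          refine Finset.sum_congr rfl fun o _ => ?_
          ext a b
          simp only [hd, mapG, kroneckerMap_apply, Matrix.sum_apply, Finset.mul_sum]
      _ = ∑ j : {o // d o ≠ 0}, c j ⊗ₖ d j := by
          refine (Fintype.sum_of_injective Subtype.val Subtype.val_injective _ _
            (fun o ho => ?_) fun j => rfl).symm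
          have : d o = 0 := by
            by_contra h
            exact ho ⟨⟨o, h⟩, rfl⟩
          rw [this, kronecker_zero]
      _ = ∑ i, C i ⊗ₖ D i := by
          refine Fintype.sum_of_injective e e.injective _ _ (fun i hi => ?_) fun j => ?_
          · rw [hDn i hi, kronecker_zero]
          · rw [hCe, hDe]
  · rw [← he, hCe, hc0]
  · rw [← he, hDe, hd0]
  · by_cases hi : i ∈ Set.range e
    · by_cases hj : j ∈ Set.range e
      · obtain ⟨i, rfl⟩ := hi
        obtain ⟨j, rfl⟩ := hj
        have hne : (i : Option (Fin N)) ≠ j := fun h => hij (by rw [Subtype.ext h])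
        rw [hCe, hCe, hDe, hDe]
        exact ⟨hcorth _ _ hne, hdorth _ _ hne⟩
      · simp [hCn j hj, hDn j hj]
    · simp [hCn i hi, hDn i hi]

end schmidt

/-! ### Exchange of the tensor factors and assembly -/

section normalForm
open Matrix

variable {k m n : ℕ} {P : Fin n → Matrix (Fin k) (Fin k) ℂ} {Q : Fin n → Matrix (Fin m) (Fin m) ℂ}

theorem finrank_ker_submatrix_swap (A : Matrix (Fin k × Fin m) (Fin k × Fin m) ℂ) :
    Module.finrank ℂ (LinearMap.ker (A.submatrix Prod.swap Prod.swap :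
      Matrix (Fin m × Fin k) (Fin m × Fin k) ℂ).mulVecLin) =
      Module.finrank ℂ (LinearMap.ker A.mulVecLin) := by
  have h1 := LinearMap.finrank_range_add_finrank_ker A.mulVecLin
  have h2 := LinearMap.finrank_range_add_finrank_ker (A.submatrix Prod.swap Prod.swap :
    Matrix (Fin m × Fin k) (Fin m × Fin k) ℂ).mulVecLin
  have h3 : (A.submatrix Prod.swap Prod.swap : Matrix (Fin m × Fin k) (Fin m × Fin k) ℂ).rank =
      A.rank := rank_submatrix A (Equiv.prodComm _ _) (Equiv.prodComm _ _)
  rw [rank, rank] at h3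
  simp only [Module.finrank_fintype_fun_eq_card, Fintype.card_prod, Fintype.card_fin] at h1 h2
  rw [mul_comm m k] at h2
  omega

theorem exists_scaling_of_finrank_ker_lt (hk : 0 < k) (hm : 0 < m)
    (hpsd : (∑ i, P i ⊗ₖ Q i).PosSemidef) (hG : (mapG P Q 1).PosDef) (hF : (mapF P Q 1).PosDef)
    (hker : (Module.finrank ℂ (LinearMap.ker (∑ i, P i ⊗ₖ Q i).mulVecLin) : ℝ) <
      (max k m : ℝ) / (min k m : ℝ)) :
    ∃ (U : Matrix (Fin k) (Fin k) ℂ) (V : Matrix (Fin m) (Fin m) ℂ) (b : ℝ), IsUnit U ∧ IsUnit V ∧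
      0 < b ∧ mapG (fun i => U * P i * Uᴴ) (fun i => V * Q i * Vᴴ) 1 = (b : ℂ) • 1 ∧
      mapF (fun i => U * P i * Uᴴ) (fun i => V * Q i * Vᴴ) 1 = ((m / k * b : ℝ) : ℂ) • 1 := by
  have hkR : (0 : ℝ) < k := by exact_mod_cast hk
  have hmR : (0 : ℝ) < m := by exact_mod_cast hm
  rcases le_total k m with hkm | hmk
  · have hkm' : (k : ℝ) ≤ m := by exact_mod_cast hkm
    rw [max_eq_right hkm', min_eq_left hkm', lt_div_iff₀ hkR, mul_comm] at hker
    obtain ⟨U, V, hU, hV, h1, h2⟩ := exists_scaling hk hm hpsd hG (by exact_mod_cast hker)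
    exact ⟨U, V, 1, hU, hV, one_pos, by simpa using h1, by simpa using h2⟩
  · have hmk' : (m : ℝ) ≤ k := by exact_mod_cast hmk
    rw [max_eq_left hmk', min_eq_right hmk', lt_div_iff₀ hmR, mul_comm,
      ← finrank_ker_submatrix_swap, ← sum_kronecker_swap] at hker
    have hpsd' : (∑ i, Q i ⊗ₖ P i).PosSemidef := by
      rw [sum_kronecker_swap]
      exact hpsd.submatrix _
    obtain ⟨V, U, hV, hU, h1, h2⟩ := exists_scaling hm hk hpsd' hF (by exact_mod_cast hker)
    -- With the factors exchanged it is `F_A(1)` that becomes `1`, and `G_A(1)` is then `k / m`.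
    refine ⟨U, V, k / m, hU, hV, by positivity, h2, ?_⟩
    rw [show (m / k * (k / m) : ℝ) = 1 by field_simp, Complex.ofReal_one, one_smul]
    exact h1

end normalForm

open Matrix in
theorem theorem4p4 (k m n : ℕ) (hk : 0 < k) (hm : 0 < m)
    (A : Matrix (Fin k × Fin m) (Fin k × Fin m) ℂ)
    (P : Fin n → Matrix (Fin k) (Fin k) ℂ) (Q : Fin n → Matrix (Fin m) (Fin m) ℂ)
    (hA : A = ∑ i, P i ⊗ₖ Q i)
    (hpsd : A.PosSemidef)
    (hG : (mapG P Q 1).PosDef)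
    (hF : (mapF P Q 1).PosDef)
    (hker : (Module.finrank ℂ (LinearMap.ker A.mulVecLin) : ℝ)
      < (max k m : ℝ) / (min k m : ℝ)) :
    HasFilterNormalForm n A := by
  subst hA
  have hkR : (0 : ℝ) < k := by exact_mod_cast hk
  have hmR : (0 : ℝ) < m := by exact_mod_cast hm
  obtain ⟨U, V, b, hU, hV, hb, hG1, hF1⟩ :=
    exists_scaling_of_finrank_ker_lt hk hm hpsd hG hF hker
  -- Replacing `U` by `t U` multiplies both partial traces by `t²`. Their ratio is already `m / k`,
  -- so `t² b = √(k/m)` also makes the other one `√(m/k)`.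
  set t : ℝ := √(√(k / m) / b) with ht
  have htt : t * t = √(k / m) / b := Real.mul_self_sqrt (by positivity)
  have ht0 : t ≠ 0 := (Real.sqrt_pos.mpr (by positivity)).ne'
  have hstar : star (t : ℂ) = t := Complex.conj_ofReal t
  have hG2 : mapG (fun i => ((t : ℂ) • U) * P i * ((t : ℂ) • U)ᴴ) (fun i => V * Q i * Vᴴ) 1 =
      ((√(k / m) : ℝ) : ℂ) • 1 := by
    rw [mapG_conj, Matrix.mul_one] at hG1 ⊢
    rw [conjTranspose_smul, hstar, Matrix.smul_mul, Matrix.mul_smul, smul_smul, ← mapGLin_apply,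
      map_smul, mapGLin_apply, Matrix.mul_smul, Matrix.smul_mul, hG1, smul_smul,
      ← Complex.ofReal_mul, ← Complex.ofReal_mul, htt, div_mul_cancel₀ _ hb.ne']
  have hF2 : mapF (fun i => ((t : ℂ) • U) * P i * ((t : ℂ) • U)ᴴ) (fun i => V * Q i * Vᴴ) 1 =
      ((√(m / k) : ℝ) : ℂ) • 1 := by
    change mapG (fun i => V * Q i * Vᴴ) (fun i => ((t : ℂ) • U) * P i * ((t : ℂ) • U)ᴴ) 1 = _
    change mapG (fun i => V * Q i * Vᴴ) (fun i => U * P i * Uᴴ) 1 = _ at hF1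
    have hval : t * t * (m / k * b) = √(m / k) := by
      rw [htt, show √((k : ℝ) / m) / b * (m / k * b) = √(k / m) * (m / k) by field_simp,
        ← Real.mul_self_sqrt (show (0 : ℝ) ≤ m / k by positivity), ← mul_assoc,
        ← Real.sqrt_mul (by positivity), show (k : ℝ) / m * (m / k) = 1 by field_simp,
        Real.sqrt_one, one_mul, Real.sqrt_mul_self (by positivity)]
    rw [mapG_conj] at hF1 ⊢
    rw [conjTranspose_smul, hstar, Matrix.smul_mul, Matrix.smul_mul, Matrix.mul_smul, hF1,
      smul_smul, smul_smul, ← Complex.ofReal_mul, ← Complex.ofReal_mul, hval]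
  have hB : (∑ i, (((t : ℂ) • U) * P i * ((t : ℂ) • U)ᴴ) ⊗ₖ (V * Q i * Vᴴ)).IsHermitian := by
    rw [← sum_kronecker_conj]
    exact (hpsd.mul_mul_conjTranspose_same _).isHermitian
  obtain ⟨C, D, hCD, h0, horth⟩ := exists_schmidt hk hm hB hG2 hF2
  refine ⟨(t : ℂ) • U, V, C, D, ?_, hV, ?_, h0, horth⟩
  · exact hU.smul (Units.mk0 (t : ℂ) (Complex.ofReal_ne_zero.mpr ht0))
  · rw [sum_kronecker_conj, hCD]
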